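/- Let $F$ be a field of characteristic $0$; algebras over $F$ are not assumed to be associative or unital. Write $(x,y,z)=(xy)z-x(yz)$ and $[x,y]=xy-yx$. Let $\mathcal V$ be the variety of $F$-algebras defined by the identities \[ (x,y,x)=0,\qquad (x^2,y,x)=0,\qquad ([x,y],z,z)=0, \] that is, the variety of noncommutative Jordan algebras satisfying $([x,y],z,z)=0$. For $n\ge 1$ let $\mathcal V_n\subseteq\mathcal V$ be the subvariety generated by the free algebra of $\mathcal V$ on $n$ free generators. The basic rank $r_b(\mathcal V)$ is the least $n\ge 1$ with $\mathcal V_n=\mathcal V$ if such an $n$ exists, and is infinite otherwise. Then $r_b(\mathcal V)$ is infinite, i.e. $\mathcal V_n\neq\mathcal V$ for every $n\ge 1$. -/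

import Mathlib

universe u v

/-- Not necessarily associative, non-unital polynomials over `F` in the variables `X`:
the free nonassociative `F`-algebra on `X`. -/
abbrev NAPoly (F : Type u) [Field F] (X : Type v) : Type (max u v) :=
  FreeNonUnitalNonAssocAlgebra F X

/-- The (not necessarily associative, not necessarily unital) `F`-algebra `A` satisfies all the
identities `f = 0`, `f ∈ I`. The variety defined by `I` is the class of all such algebras. -/
def SatisfiesIdentities {F : Type u} [Field F] (I : Set (NAPoly F ℕ))
    (A : Type v) [NonUnitalNonAssocRing A] [Module F A] [IsScalarTower F A A]
    [SMulCommClass F A A] : Prop :=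
  ∀ f ∈ I, ∀ a : ℕ → A, FreeNonUnitalNonAssocAlgebra.lift F a f = 0

/-- The set of all identities of the algebra `A`. The variety it defines is the variety
generated by `A`. -/
def identitiesOf (F : Type u) [Field F]
    (A : Type v) [NonUnitalNonAssocRing A] [Module F A] [IsScalarTower F A A]
    [SMulCommClass F A A] : Set (NAPoly F ℕ) :=
  {f | ∀ a : ℕ → A, FreeNonUnitalNonAssocAlgebra.lift F a f = 0}

/-- Two sets of identities define the same variety. -/
def SameVariety {F : Type u} [Field F] (I J : Set (NAPoly F ℕ)) : Prop :=
  ∀ (A : Type u) [NonUnitalNonAssocRing A] [Module F A] [IsScalarTower F A A]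
    [SMulCommClass F A A], SatisfiesIdentities I A ↔ SatisfiesIdentities J A

/-- The two-sided ideal of the free nonassociative algebra on `X` generated by all values of the
polynomials in `I`. -/
noncomputable def verbalIdeal {F : Type u} [Field F] (I : Set (NAPoly F ℕ)) (X : Type v) :
    Submodule F (NAPoly F X) :=
  sInf {J | (∀ f ∈ I, ∀ a : ℕ → NAPoly F X, FreeNonUnitalNonAssocAlgebra.lift F a f ∈ J) ∧
    ∀ p q : NAPoly F X, q ∈ J → p * q ∈ J ∧ q * p ∈ J}

theorem mul_mem_verbalIdeal {F : Type u} [Field F] (I : Set (NAPoly F ℕ)) (X : Type v)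
    (p q : NAPoly F X) (hq : q ∈ verbalIdeal I X) :
    p * q ∈ verbalIdeal I X ∧ q * p ∈ verbalIdeal I X := by
  simp only [verbalIdeal, Submodule.mem_sInf] at hq ⊢
  exact ⟨fun J hJ => (hJ.2 p q (hq J hJ)).1, fun J hJ => (hJ.2 p q (hq J hJ)).2⟩

/-- The free algebra on `X` in the variety defined by `I`. -/
def VarietyFree {F : Type u} [Field F] (I : Set (NAPoly F ℕ)) (X : Type v) : Type (max u v) :=
  NAPoly F X ⧸ verbalIdeal I X

namespace VarietyFree

variable {F : Type u} [Field F] (I : Set (NAPoly F ℕ)) (X : Type v)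

noncomputable instance : AddCommGroup (VarietyFree I X) :=
  inferInstanceAs (AddCommGroup (NAPoly F X ⧸ verbalIdeal I X))

noncomputable instance : Module F (VarietyFree I X) :=
  inferInstanceAs (Module F (NAPoly F X ⧸ verbalIdeal I X))

/-- The quotient map. -/
noncomputable def mk : NAPoly F X →ₗ[F] VarietyFree I X := (verbalIdeal I X).mkQ

theorem mk_surjective : Function.Surjective (mk I X) := (verbalIdeal I X).mkQ_surjective

theorem mk_eq_mk_iff (p q : NAPoly F X) : mk I X p = mk I X q ↔ p - q ∈ verbalIdeal I X :=
  Submodule.Quotient.eq _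

noncomputable instance : Mul (VarietyFree I X) where
  mul := Quotient.map₂ (fun p q => p * q) (by
    intro p p' hp q q' hq
    have hp' := (Submodule.quotientRel_def _).1 hp
    have hq' := (Submodule.quotientRel_def _).1 hq
    refine (Submodule.quotientRel_def _).2 ?_
    have h := (verbalIdeal I X).add_mem (mul_mem_verbalIdeal I X q _ hp').2
      (mul_mem_verbalIdeal I X p' _ hq').1
    have e : p * q - p' * q' = (p - p') * q + p' * (q - q') := by
      rw [sub_mul, mul_sub]; abel
    rw [e]
    exact h)

theorem mk_mul (p q : NAPoly F X) : mk I X (p * q) = mk I X p * mk I X q := rfl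

noncomputable instance : NonUnitalNonAssocRing (VarietyFree I X) :=
  { (inferInstance : AddCommGroup (VarietyFree I X)),
    (inferInstance : Mul (VarietyFree I X)) with
    left_distrib := by
      intro a b c
      obtain ⟨a, rfl⟩ := mk_surjective I X a
      obtain ⟨b, rfl⟩ := mk_surjective I X b
      obtain ⟨c, rfl⟩ := mk_surjective I X c
      rw [← map_add, ← mk_mul, mul_add, map_add, mk_mul, mk_mul]
    right_distrib := by
      intro a b c
      obtain ⟨a, rfl⟩ := mk_surjective I X a
      obtain ⟨b, rfl⟩ := mk_surjective I X b
      obtain ⟨c, rfl⟩ := mk_surjective I X c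
      rw [← map_add, ← mk_mul, add_mul, map_add, mk_mul, mk_mul]
    zero_mul := by
      intro a
      obtain ⟨a, rfl⟩ := mk_surjective I X a
      rw [← map_zero (mk I X), ← mk_mul, zero_mul]
    mul_zero := by
      intro a
      obtain ⟨a, rfl⟩ := mk_surjective I X a
      rw [← map_zero (mk I X), ← mk_mul, mul_zero] }

instance : IsScalarTower F (VarietyFree I X) (VarietyFree I X) where
  smul_assoc := by
    intro c a b
    obtain ⟨a, rfl⟩ := mk_surjective I X a
    obtain ⟨b, rfl⟩ := mk_surjective I X b
    simp only [smul_eq_mul]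
    rw [← map_smul, ← mk_mul, ← mk_mul, smul_mul_assoc, map_smul]

instance : SMulCommClass F (VarietyFree I X) (VarietyFree I X) where
  smul_comm := by
    intro c a b
    obtain ⟨a, rfl⟩ := mk_surjective I X a
    obtain ⟨b, rfl⟩ := mk_surjective I X b
    simp only [smul_eq_mul]
    rw [← map_smul, ← mk_mul, ← mk_mul, mul_smul_comm, map_smul]

end VarietyFree

/-- For the variety `𝒱` defined by `I`, the identities defining the subvariety `𝒱ₙ` generated by
the `𝒱`-free algebra on `n` free generators. -/
def rankSubvariety {F : Type u} [Field F] (I : Set (NAPoly F ℕ)) (n : ℕ) : Set (NAPoly F ℕ) :=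
  identitiesOf F (VarietyFree I (Fin n))

/-- The basic rank of the variety `𝒱` defined by `I`: the least `n ≥ 1` with `𝒱ₙ = 𝒱`, and `⊤`
if there is no such `n`. -/
noncomputable def basicRank {F : Type u} [Field F] (I : Set (NAPoly F ℕ)) : ℕ∞ :=
  sInf {r : ℕ∞ | ∃ n : ℕ, 1 ≤ n ∧ r = n ∧ SameVariety (rankSubvariety I n) I}

/-- The variable `x_i`. -/
noncomputable abbrev NAPoly.var (F : Type u) [Field F] (i : ℕ) : NAPoly F ℕ :=
  FreeNonUnitalNonAssocAlgebra.of F i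

/-- The defining identities `(x, y, x) = 0` and `(x², y, x) = 0` of noncommutative Jordan algebras,
where `(x, y, z) = (x y) z - x (y z)`. -/
noncomputable def ncJordanIdentities (F : Type u) [Field F] : Set (NAPoly F ℕ) :=
  let x := NAPoly.var F 0
  let y := NAPoly.var F 1
  {associator x y x, associator (x * x) y x}

/-- The identities of noncommutative Jordan algebras together with `([x, y], z, z) = 0`. -/
noncomputable def ncJordanCommIdentities (F : Type u) [Field F] : Set (NAPoly F ℕ) :=
  let x := NAPoly.var F 0
  let y := NAPoly.var F 1
  let z := NAPoly.var F 2
  ncJordanIdentities F ∪ {associator (x * y - y * x) z z}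

/-! ### Noncommutative Jordan algebras with `([x, y], z, z) = 0` in terms of two operations -/

/-! Write x·y for the symmetrized product `jprod` and {x, y} for the commutator `jcomm`. In
characteristic 0 the defining identities imply that every {·, z} is a derivation of the symmetrized
product, that this product is Jordan, and that every commutator w satisfies (w, z, z) = 0.

The element u = {{{a,x},a},x} - {{{a,x},x},a} (`wronskian`) is annihilated by every commutator c, in
the sense that {u, c}, u·c, u·(c·y) and (u·y)·c all vanish. The identities {u, c} = 0, {{u, y}, c} =
0 and u·c = 0 are finite computations settled by kernel-checked certificates; the rest follows by
linear algebra. This annihilation property passes from u to {u, z} (`AnnihilatesComm.jcomm`).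

Consequently {…{u, y₀}, …, yₘ₋₁} vanishes when some yᵢ is a commutator and is a derivation of the
symmetrized product in each yᵢ. Its alternating sum over the yᵢ is therefore determined by its
values on generators, and with m > n slots and n generators two slots coincide, so it vanishes
(`altIterComm_eq_zero`). Thus the alternating polynomial with n + 1 slots is an identity of the free
algebra on n generators.

It is not an identity of the whole variety: `WedgeAlgebra` is an anticommutative member in which
bracketing with a vector acts on the exterior part as twice the wedge product, so the polynomial
takes as value a nonzero multiple of the top form e₀ ∧ … ∧ eₘ₊₁. -/

section Operations

variable {A : Type*} [NonUnitalNonAssocRing A]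

/-- The symmetrized product `x y + y x`. -/
def jprod (x y : A) : A := x * y + y * x

/-- The commutator `x y - y x`. -/
def jcomm (x y : A) : A := x * y - y * x

theorem jprod_comm (x y : A) : jprod x y = jprod y x := add_comm _ _

theorem jcomm_skew (x y : A) : jcomm x y = -jcomm y x := by simp [jcomm]

theorem jcomm_self (x : A) : jcomm x x = 0 := sub_self _

theorem jprod_add (x y z : A) : jprod x (y + z) = jprod x y + jprod x z := by
  simp only [jprod, mul_add, add_mul]; abel

theorem add_jprod (x y z : A) : jprod (x + y) z = jprod x z + jprod y z := by
  simp only [jprod, mul_add, add_mul]; abel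

theorem jcomm_add (x y z : A) : jcomm x (y + z) = jcomm x y + jcomm x z := by
  simp only [jcomm, mul_add, add_mul]; abel

theorem add_jcomm (x y z : A) : jcomm (x + y) z = jcomm x z + jcomm y z := by
  simp only [jcomm, mul_add, add_mul]; abel

/-- `jprod` as a biadditive map. -/
def jprodHom : A →+ A →+ A :=
  AddMonoidHom.mk' (fun x => AddMonoidHom.mk' (jprod x) (jprod_add x))
    fun x y => AddMonoidHom.ext (add_jprod x y)

/-- `jcomm` as a biadditive map. -/
def jcommHom : A →+ A →+ A :=
  AddMonoidHom.mk' (fun x => AddMonoidHom.mk' (jcomm x) (jcomm_add x))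
    fun x y => AddMonoidHom.ext (add_jcomm x y)

theorem jprodHom_apply (x y : A) : jprodHom x y = jprod x y := rfl

@[simp] theorem jprod_zero (x : A) : jprod x 0 = 0 := by simp [jprod]

@[simp] theorem zero_jprod (x : A) : jprod 0 x = 0 := by simp [jprod]

@[simp] theorem zero_jcomm (x : A) : jcomm 0 x = 0 := by simp [jcomm]

/-- The polarization of `(w, z, z) = 0` in terms of `jprod` and `jcomm`, as satisfied by a
commutator `w`. -/
def RightAlternates (w : A) : Prop :=
  ∀ z t : A, jcomm (jcomm w z) t + jcomm (jcomm w t) z - (2 : ℤ) • jprod w (jprod z t)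
    + jprod (jprod w z) t + jprod (jprod w t) z = 0

/-- The polarized Jordan identity for `jprod`. -/
def jordanDefect (x z t y : A) : A :=
  jprod (jprod (jprod x z) y) t - jprod (jprod x z) (jprod y t)
    + (jprod (jprod (jprod z t) y) x - jprod (jprod z t) (jprod y x))
    + (jprod (jprod (jprod t x) y) z - jprod (jprod t x) (jprod y z))

variable (A) in
/-- The polarized defining identities of noncommutative Jordan algebras satisfying
`([x, y], z, z) = 0`. -/
structure IsNCJordanComm : Prop where
  jprod_jcomm : ∀ x y z : A, jcomm (jprod x y) z = jprod x (jcomm y z) + jprod y (jcomm x z)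
  jordan : ∀ x z t y : A, jordanDefect x z t y = 0
  rightAlternates : ∀ x y : A, RightAlternates (jcomm x y)

theorem IsNCJordanComm.jcomm_jprod (h : IsNCJordanComm A) (x y z : A) :
    jcomm x (jprod y z) = jprod y (jcomm x z) + jprod z (jcomm x y) := by
  rw [jcomm_skew, h.jprod_jcomm, jcomm_skew z x, jcomm_skew y x]
  simp only [← jprodHom_apply, map_neg]
  abel

end Operations

/-! ### A verified checker for consequences of these identities -/

/-- Formal monomials in two binary operations. -/
inductive Mon : Type
  | var (i : ℕ)
  | dot (p q : Mon)
  | br (p q : Mon)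

namespace Mon

instance : Mul Mon := ⟨dot⟩

instance : Bracket Mon Mon := ⟨br⟩

/-- A total order on monomials. -/
def cmp : Mon → Mon → Ordering
  | var i, var j => if i = j then .eq else if i < j then .lt else .gt
  | var _, _ => .lt
  | dot _ _, var _ => .gt
  | dot p q, dot r s => match cmp p r with
    | .eq => cmp q s
    | o => o
  | dot _ _, br _ _ => .lt
  | br p q, br r s => match cmp p r with
    | .eq => cmp q s
    | o => o
  | br _ _, _ => .gt

theorem eq_of_cmp : ∀ {p q : Mon}, cmp p q = .eq → p = q
  | var i, var j, h => by
    simp only [cmp] at h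
    split_ifs at h with h1
    rw [h1]
  | var _, dot _ _, h => by simp [cmp] at h
  | var _, br _ _, h => by simp [cmp] at h
  | dot _ _, var _, h => by simp [cmp] at h
  | dot _ _, br _ _, h => by simp [cmp] at h
  | br _ _, var _, h => by simp [cmp] at h
  | br _ _, dot _ _, h => by simp [cmp] at h
  | dot p q, dot r s, h => by
    simp only [cmp] at h
    split at h
    · next h1 => rw [eq_of_cmp h1, eq_of_cmp h]
    · next h1 => exact absurd h h1
  | br p q, br r s, h => by
    simp only [cmp] at h
    split at h
    · next h1 => rw [eq_of_cmp h1, eq_of_cmp h]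
    · next h1 => exact absurd h h1

/-- The symmetrized product of monomials, with ordered factors. -/
def sdot (p q : Mon) : Mon :=
  match cmp p q with
  | .gt => dot q p
  | _ => dot p q

/-- Formal linear combinations of monomials. -/
abbrev Comb : Type := List (Mon × ℤ)

/-- The commutator with second argument expanded by the Leibniz rule. -/
def sbrRight (p : Mon) : Mon → Comb
  | dot q r => ((sbrRight p r).map fun c => (sdot q c.1, c.2)) ++
      (sbrRight p q).map fun c => (sdot r c.1, c.2)
  | q => match cmp p q with
    | .eq => []
    | .lt => [(br p q, 1)]
    | .gt => [(br q p, -1)]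

/-- The commutator of monomials, expanded by the Leibniz rule. -/
def sbr : Mon → Mon → Comb
  | dot p q, r => ((sbr q r).map fun c => (sdot p c.1, c.2)) ++
      (sbr p r).map fun c => (sdot q c.1, c.2)
  | p, r => sbrRight p r

/-- Bilinear extension. -/
def Comb.bilin (f : Mon → Mon → Comb) (a b : Comb) : Comb :=
  a.flatMap fun c => b.flatMap fun d => (f c.1 d.1).map fun e => (e.1, c.2 * d.2 * e.2)

/-- Polynomial expressions. -/
inductive Form : Type
  | mon (m : Mon)
  | smul (n : ℤ) (p : Form)
  | add (p q : Form)
  | dot (p q : Form)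
  | br (p q : Form)

/-- Normal form of a polynomial expression. -/
def Form.norm : Form → Comb
  | mon m => [(m, 1)]
  | smul n p => p.norm.map fun c => (c.1, n * c.2)
  | add p q => p.norm ++ q.norm
  | dot p q => Comb.bilin (fun m n => [(sdot m n, 1)]) p.norm q.norm
  | br p q => Comb.bilin sbr p.norm q.norm

/-- Merge two linear combinations with increasing monomials; the first argument bounds the number
of steps. -/
def Comb.merge : ℕ → Comb → Comb → Comb
  | 0, a, b => a ++ b
  | _ + 1, [], b => b
  | _ + 1, c :: a, [] => c :: a
  | k + 1, c :: a, d :: b => match cmp c.1 d.1 with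
    | .lt => c :: merge k a (d :: b)
    | .eq => (c.1, c.2 + d.2) :: merge k a b
    | .gt => d :: merge k (c :: a) b

/-- Merge adjacent linear combinations. -/
def Comb.mergePairs : List Comb → List Comb
  -- The bound is only fuel: when it runs out the lists are concatenated, so the value never
  -- changes.
  | a :: b :: l => Comb.merge 100000 a b :: mergePairs l
  | l => l

/-- Sum of linear combinations, with terms collected if the first argument is large enough. -/
def Comb.mergeAll : ℕ → List Comb → Comb
  | 0, l => l.flatten
  | k + 1, l => mergeAll k (Comb.mergePairs l)

/-- Collect terms and test whether all coefficients vanish. -/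
def Comb.isZero (a : Comb) : Bool :=
  -- Each round halves the number of lists, so 20 rounds cover up to 2²⁰ terms. For longer inputs
  -- the test may fail but stays sound.
  (Comb.mergeAll 20 (a.map fun c => [c])).all fun c => decide (c.2 = 0)

/-- Formal consequences of the defining identities. The variable `k` in `altVar k` is one whose
value satisfies `RightAlternates`. -/
inductive Rel : Type
  | alt (p q z t : Mon)
  | altVar (k : ℕ) (z t : Mon)
  | leibniz (p q r s : Mon)
  | jordan (x z t y : Mon)
  | mul (m : Mon) (r : Rel)
  | bra (m : Mon) (r : Rel)

open Form in
/-- The polarization of `(w, z, z)`. -/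
def Form.altForm (w z t : Form) : Form :=
  add (add (add (add (br (br w z) t) (br (br w t) z)) (smul (-2) (dot w (dot z t))))
    (dot (dot w z) t)) (dot (dot w t) z)

open Form in
/-- One third of the polarized Jordan identity. -/
def Form.jordanPart (x z t y : Mon) : Form :=
  add (dot (dot (dot (mon x) (mon z)) (mon y)) (mon t))
    (smul (-1) (dot (dot (mon x) (mon z)) (dot (mon y) (mon t))))

open Form in
/-- `p · {q, r s} + q · {p, r s}` with the inner commutators expanded. -/
def Form.leibnizPart (p q r s : Mon) : Form :=
  add (dot (mon p) (add (dot (mon r) (br (mon q) (mon s))) (dot (mon s) (br (mon q) (mon r)))))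
    (dot (mon q) (add (dot (mon r) (br (mon p) (mon s))) (dot (mon s) (br (mon p) (mon r)))))

/-- The polynomial expression asserted to vanish. -/
def Rel.form : Rel → Form
  | alt p q z t => Form.altForm (.br (.mon p) (.mon q)) (.mon z) (.mon t)
  | altVar k z t => Form.altForm (.mon (var k)) (.mon z) (.mon t)
  | leibniz p q r s => .add (Form.leibnizPart p q r s) (Form.leibnizPart r s p q)
  | jordan x z t y =>
    .add (.add (Form.jordanPart x z t y) (Form.jordanPart z t x y)) (Form.jordanPart t x z y)
  | mul m r => .dot r.form (.mon m)
  | bra m r => .br r.form (.mon m)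

/-- The variable of a relation required to satisfy `RightAlternates` is `k`. -/
def Rel.uses (k : ℕ) : Rel → Bool
  | altVar j _ _ => j == k
  | mul _ r => r.uses k
  | bra _ r => r.uses k
  | _ => true

/-- Verify that `n` times the goal is the given linear combination of relations. -/
def check (k : ℕ) (n : ℤ) (goal : Form) (cert : List (ℤ × Rel)) : Bool :=
  cert.all (fun c => c.2.uses k) &&
    Comb.isZero ((Form.smul (-n) goal).norm ++ cert.flatMap fun c => (Form.smul c.1 c.2.form).norm)

/-! ### Soundness of the checker -/

section Soundness

variable {A : Type*} [NonUnitalNonAssocRing A] (v : ℕ → A)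

/-- Evaluation of monomials. -/
def eval : Mon → A
  | var i => v i
  | dot p q => jprod p.eval q.eval
  | br p q => jcomm p.eval q.eval

/-- Evaluation of linear combinations. -/
def Comb.eval (a : Comb) : A := (a.map fun c => c.2 • c.1.eval v).sum

/-- Evaluation of polynomial expressions. -/
def Form.eval : Form → A
  | mon m => m.eval v
  | smul n p => n • p.eval
  | add p q => p.eval + q.eval
  | dot p q => jprod p.eval q.eval
  | br p q => jcomm p.eval q.eval

theorem eval_sdot (p q : Mon) : (sdot p q).eval v = jprod (p.eval v) (q.eval v) := by
  unfold sdot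
  split
  · exact jprod_comm _ _
  · rfl

theorem Comb.eval_nil : Comb.eval v [] = 0 := rfl

theorem Comb.eval_cons (c : Mon × ℤ) (a : Comb) :
    Comb.eval v (c :: a) = c.2 • c.1.eval v + Comb.eval v a := by
  simp [Comb.eval]

theorem Comb.eval_append (a b : Comb) :
    Comb.eval v (a ++ b) = Comb.eval v a + Comb.eval v b := by
  simp [Comb.eval]

theorem Comb.eval_map_sdot (p : Mon) (a : Comb) :
    Comb.eval v (a.map fun c => (sdot p c.1, c.2)) = jprod (p.eval v) (Comb.eval v a) := by
  induction a with
  | nil => simp [Comb.eval_nil]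
  | cons c a ih =>
    rw [List.map_cons, Comb.eval_cons, Comb.eval_cons, ih, jprod_add, eval_sdot]
    simp only [← jprodHom_apply, map_zsmul]

theorem Comb.eval_map_mul (n : ℤ) (a : Comb) :
    Comb.eval v (a.map fun c => (c.1, n * c.2)) = n • Comb.eval v a := by
  induction a with
  | nil => simp [Comb.eval_nil]
  | cons c a ih => rw [List.map_cons, Comb.eval_cons, Comb.eval_cons, ih, smul_add, mul_smul]

theorem Comb.eval_bilin (f : Mon → Mon → Comb) (g : A →+ A →+ A)
    (h : ∀ p q, Comb.eval v (f p q) = g (p.eval v) (q.eval v)) (a b : Comb) :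
    Comb.eval v (Comb.bilin f a b) = g (Comb.eval v a) (Comb.eval v b) := by
  unfold Comb.bilin
  induction a with
  | nil => simp [Comb.eval_nil]
  | cons c a ih =>
    rw [List.flatMap_cons, Comb.eval_append, ih, Comb.eval_cons, map_add, AddMonoidHom.add_apply]
    congr 1
    clear ih
    induction b with
    | nil => simp [Comb.eval_nil]
    | cons d b ih =>
      rw [List.flatMap_cons, Comb.eval_append, ih, Comb.eval_cons, map_add, Comb.eval_map_mul, h]
      simp only [map_zsmul, AddMonoidHom.coe_smul, Pi.smul_apply, mul_smul]
      rw [smul_comm d.2]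

theorem Comb.eval_merge (k : ℕ) (a b : Comb) :
    Comb.eval v (Comb.merge k a b) = Comb.eval v a + Comb.eval v b := by
  induction k generalizing a b with
  | zero => exact Comb.eval_append v a b
  | succ k ih =>
    match a, b with
    | [], b => simp [Comb.merge, Comb.eval_nil]
    | c :: a, [] => simp [Comb.merge, Comb.eval_nil]
    | c :: a, d :: b =>
      unfold Comb.merge
      split
      · simp only [Comb.eval_cons, ih]; abel
      · next h => simp only [Comb.eval_cons, ih, eq_of_cmp h, add_smul]; abel
      · simp only [Comb.eval_cons, ih]; abel

theorem Comb.eval_mergePairs (l : List Comb) :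
    Comb.eval v (Comb.mergePairs l).flatten = Comb.eval v l.flatten := by
  induction l using Comb.mergePairs.induct with
  | case1 a b l ih =>
    simp only [Comb.mergePairs, List.flatten_cons, Comb.eval_append, Comb.eval_merge, ih, add_assoc]
  | case2 l h => rw [Comb.mergePairs]; exact h

theorem Comb.eval_mergeAll (k : ℕ) (l : List Comb) :
    Comb.eval v (Comb.mergeAll k l) = Comb.eval v l.flatten := by
  induction k generalizing l with
  | zero => rfl
  | succ k ih => rw [Comb.mergeAll, ih, Comb.eval_mergePairs]

theorem Comb.eval_of_isZero (a : Comb) (h : a.isZero = true) : Comb.eval v a = 0 := by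
  have e : (a.map fun c => [c]).flatten = a := by
    clear h
    induction a with
    | nil => rfl
    | cons c a ih => simp [ih]
  rw [← e, ← Comb.eval_mergeAll v 20]
  simp only [Comb.isZero, List.all_eq_true, decide_eq_true_eq] at h
  refine List.sum_eq_zero fun x hx => ?_
  obtain ⟨c, hc, rfl⟩ := List.mem_map.1 hx
  rw [h c hc, zero_smul]

theorem eval_sbrRight (hA : IsNCJordanComm A) (p q : Mon) :
    Comb.eval v (sbrRight p q) = jcomm (p.eval v) (q.eval v) := by
  have base : ∀ q, Comb.eval v (match cmp p q with
    | .eq => []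
    | .lt => [(br p q, 1)]
    | .gt => [(br q p, -1)]) = jcomm (p.eval v) (q.eval v) := by
    intro q
    split
    · next h => rw [eq_of_cmp h, jcomm_self]; rfl
    · simp [Comb.eval, Mon.eval]
    · simp [Comb.eval, Mon.eval, jcomm_skew (p.eval v)]
  induction q with
  | var i => exact base (var i)
  | br q r _ _ => exact base (br q r)
  | dot q r ihq ihr =>
    rw [sbrRight, Comb.eval_append, Comb.eval_map_sdot, Comb.eval_map_sdot, ihq, ihr]
    exact (hA.jcomm_jprod _ _ _).symm

theorem eval_sbr (hA : IsNCJordanComm A) (p q : Mon) :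
    Comb.eval v (sbr p q) = jcomm (p.eval v) (q.eval v) := by
  induction p with
  | var i => exact eval_sbrRight v hA _ _
  | br p r _ _ => exact eval_sbrRight v hA _ _
  | dot p r ihp ihr =>
    rw [sbr, Comb.eval_append, Comb.eval_map_sdot, Comb.eval_map_sdot, ihp, ihr]
    exact (hA.jprod_jcomm _ _ _).symm

theorem Form.eval_norm (hA : IsNCJordanComm A) (p : Form) :
    Comb.eval v p.norm = p.eval v := by
  induction p with
  | mon m => simp [Form.norm, Form.eval, Comb.eval]
  | smul n p ih => rw [Form.norm, Comb.eval_map_mul, ih, Form.eval]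
  | add p q ihp ihq => rw [Form.norm, Comb.eval_append, ihp, ihq, Form.eval]
  | dot p q ihp ihq =>
    rw [Form.norm, Comb.eval_bilin v _ jprodHom, ihp, ihq]
    · rfl
    · intro p q
      simp [Comb.eval, eval_sdot, jprodHom_apply]
  | br p q ihp ihq =>
    rw [Form.norm, Comb.eval_bilin v _ jcommHom, ihp, ihq]
    · rfl
    · exact eval_sbr v hA

theorem Form.eval_altForm {w : Form} (hw : RightAlternates (w.eval v)) (z t : Form) :
    (Form.altForm w z t).eval v = 0 := by
  have h := hw (z.eval v) (t.eval v)
  rw [sub_eq_add_neg, ← neg_smul] at h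
  exact h

theorem Form.eval_leibnizPart (hA : IsNCJordanComm A) (p q r s : Mon) :
    (Form.leibnizPart p q r s).eval v =
      jcomm (jprod (p.eval v) (q.eval v)) (jprod (r.eval v) (s.eval v)) := by
  simp only [Form.leibnizPart, Form.eval, hA.jprod_jcomm, hA.jcomm_jprod]

theorem Rel.eval_form (hA : IsNCJordanComm A) (k : ℕ) (hk : RightAlternates (v k)) (r : Rel)
    (hr : r.uses k = true) : r.form.eval v = 0 := by
  induction r with
  | alt p q z t =>
    rw [Rel.form]
    exact Form.eval_altForm v (w := .br (.mon p) (.mon q)) (hA.rightAlternates _ _) _ _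
  | altVar j z t =>
    obtain rfl : j = k := by simpa [Rel.uses] using hr
    rw [Rel.form]
    exact Form.eval_altForm v (w := .mon (var j)) hk _ _
  -- Skew-symmetry of {p·q, r·s}. It is not automatic for normal forms: as · is not associative,
  -- expanding the left or the right argument first gives different expressions.
  | leibniz p q r s =>
    rw [Rel.form, Form.eval, Form.eval_leibnizPart v hA, Form.eval_leibnizPart v hA, jcomm_skew,
      neg_add_cancel]
  | jordan x z t y =>
    have h := hA.jordan (x.eval v) (z.eval v) (t.eval v) (y.eval v)
    simpa only [jordanDefect, Rel.form, Form.jordanPart, Form.eval, neg_one_zsmul,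
      ← sub_eq_add_neg] using h
  | mul m r ih => rw [Rel.form, Form.eval, ih hr, zero_jprod]
  | bra m r ih => rw [Rel.form, Form.eval, ih hr, zero_jcomm]

/-- Normalization preserves values and every relation has value 0, so a combination cancelling -n
times the goal forces n times the goal to vanish. The factor n clears denominators and is removed
later by torsion-freeness. -/
theorem eval_eq_zero_of_check (hA : IsNCJordanComm A) (k : ℕ) (hk : RightAlternates (v k))
    (n : ℤ) (goal : Form) (cert : List (ℤ × Rel)) (h : check k n goal cert = true) :
    n • goal.eval v = 0 := by
  simp only [check, Bool.and_eq_true, List.all_eq_true] at h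
  have h2 := Comb.eval_of_isZero v _ h.2
  have key : Comb.eval v (cert.flatMap fun c => (Form.smul c.1 c.2.form).norm) = 0 := by
    have h1 := h.1
    clear h h2
    induction cert with
    | nil => rfl
    | cons c cert ih =>
      rw [List.flatMap_cons, Comb.eval_append, Form.eval_norm v hA, Form.eval,
        Rel.eval_form v hA k hk _ (h1 c List.mem_cons_self), smul_zero, zero_add,
        ih fun x hx => h1 x (List.mem_cons_of_mem _ hx)]
  rw [Comb.eval_append, key, add_zero, Form.eval_norm v hA, Form.eval, neg_smul,
    neg_eq_zero] at h2
  exact h2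

end Soundness

end Mon

/-! ### Three identities obtained from the checker -/

namespace Mon

/-- The form `{{{a, x}, a}, x} - {{{a, x}, x}, a}`. -/
def Form.wronski (a x : Mon) : Form :=
  .add (.br (.br (.br (.mon a) (.mon x)) (.mon a)) (.mon x))
    (.smul (-1) (.br (.br (.br (.mon a) (.mon x)) (.mon x)) (.mon a)))

/-- Only `RightAlternates` is assumed of the variable w, which stands for a commutator; this keeps
the degree of the computation low. -/
theorem check_jcomm_wronski :
    let a := var 0; let x := var 1; let w := var 2
    check 2 2 (.br (.wronski a x) (.mon w))
  [(2, .alt x ⁅x, w⁆ a a), (2, .alt a ⁅a, w⁆ x x), (18, .leibniz a x a ⁅x, w⁆),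
   (2, .alt x ⁅a, x⁆ a w), (2, .alt a x x ⁅a, w⁆), (2, .altVar 2 a ⁅x, ⁅a, x⁆⁆),
   (-2, .alt a ⁅a, x⁆ x w), (9, .bra a (.leibniz a w x x)), (-12, .leibniz a x w ⁅a, x⁆),
   (-2, .bra x (.alt a x a w)), (-2, .bra x (.altVar 2 a ⁅a, x⁆)),
   (-2, .bra x (.bra x (.altVar 2 a a))), (-2, .bra a (.bra a (.altVar 2 x x)))]
    = true := by decide +kernel

theorem check_jcomm_jcomm_wronski :
    let a := var 0; let x := var 1; let z := var 2; let w := var 3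
    check 3 2 (.br (.br (.wronski a x) (.mon z)) (.mon w))
  [(-6, .leibniz a x z ⁅w, ⁅a, x⁆⁆), (-2, .bra z (.bra a (.bra a (.altVar 3 x x)))),
   (-2, .bra z (.bra x (.alt a x a w))), (-12, .jordan x w (a * z) ⁅a, x⁆),
   (2, .bra z (.alt a x x ⁅a, w⁆)), (6, .mul x (.jordan a z ⁅a, x⁆ w)),
   (4, .bra x (.alt a x a ⁅z, w⁆)), (4, .bra x (.bra x (.alt z w a a))),
   (6, .jordan a x (z * ⁅a, x⁆) w), (6, .mul x (.altVar 3 (a * z) ⁅a, x⁆)),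
   (6, .altVar 3 x ((a * z) * ⁅a, x⁆)), (-2, .bra z (.bra x (.altVar 3 a ⁅a, x⁆))),
   (24, .mul z (.mul x (.alt a x a w))), (6, .altVar 3 x (a * (z * ⁅a, x⁆))),
   (-6, .mul x (.altVar 3 z (a * ⁅a, x⁆))), (-12, .mul w (.mul x (.alt a x a z))),
   (4, .altVar 3 z ⁅x, ⁅a, ⁅a, x⁆⁆⁆), (-6, .bra z (.leibniz a w x ⁅a, x⁆)),
   (2, .bra z (.alt x ⁅a, x⁆ a w)), (12, .jordan x z w (a * ⁅a, x⁆)),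
   (6, .altVar 3 (x * z) (a * ⁅a, x⁆)), (-4, .altVar 3 z ⁅a, ⁅x, ⁅a, x⁆⁆⁆),
   (9, .bra z (.bra w (.leibniz a x a x))), (-6, .jordan x z (a * ⁅a, x⁆) w),
   (24, .mul w (.jordan x z ⁅a, x⁆ a)), (-4, .alt a x x ⁅a, ⁅z, w⁆⁆),
   (4, .bra a (.bra a (.alt z w x x))), (-12, .jordan x w (z * ⁅a, x⁆) a),
   (2, .alt x ⁅a, ⁅a, x⁆⁆ z w), (-6, .altVar 3 (a * z) (x * ⁅a, x⁆)),
   (-12, .leibniz x ⁅a, x⁆ z ⁅a, w⁆), (-18, .leibniz a ⁅w, ⁅a, x⁆⁆ x z),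
   (6, .leibniz z w ⁅a, x⁆ ⁅a, x⁆), (2, .bra z (.alt x ⁅x, w⁆ a a)),
   (-6, .altVar 3 (a * x) (z * ⁅a, x⁆)), (12, .leibniz a z w ⁅x, ⁅a, x⁆⁆),
   (12, .mul w (.alt a x a (x * z))), (-4, .alt x ⁅a, x⁆ a ⁅z, w⁆),
   (30, .leibniz a ⁅z, w⁆ x ⁅a, x⁆), (18, .mul z (.mul w (.alt a x a x))),
   (-12, .alt a x a (z * (x * w))), (4, .bra x (.alt z w a ⁅a, x⁆)),
   (-6, .altVar 3 x (z * (a * ⁅a, x⁆))), (6, .jordan x (a * z) ⁅a, x⁆ w),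
   (12, .jordan a z (x * w) ⁅a, x⁆), (-6, .mul w (.mul z (.alt a x a x))),
   (12, .mul (x * w) (.alt a x a z)), (4, .alt a ⁅a, x⁆ x ⁅z, w⁆),
   (-18, .bra ⁅z, w⁆ (.leibniz a x a x)), (-9, .mul z (.mul w (.leibniz a x a x))),
   (-12, .mul z (.alt a x a (x * w))), (-24, .jordan z (x * w) ⁅a, x⁆ a),
   (-36, .mul z (.jordan x w ⁅a, x⁆ a)), (18, .leibniz a x ⁅z, w⁆ ⁅a, x⁆),
   (-2, .alt a ⁅x, ⁅a, x⁆⁆ z w), (9, .mul w (.mul z (.leibniz a x a x))),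
   (-4, .alt z w a ⁅x, ⁅a, x⁆⁆), (-6, .altVar 3 ⁅a, x⁆ (x * (a * z))),
   (-6, .altVar 3 a (x * (z * ⁅a, x⁆))), (6, .altVar 3 z (x * (a * ⁅a, x⁆))),
   (12, .mul z (.mul x (.altVar 3 a ⁅a, x⁆))), (-18, .leibniz x ⁅a, w⁆ z ⁅a, x⁆),
   (2, .bra z (.altVar 3 a ⁅x, ⁅a, x⁆⁆)), (36, .mul z (.jordan a x w ⁅a, x⁆)),
   (-12, .mul w (.jordan a x z ⁅a, x⁆)), (-2, .bra z (.alt a ⁅a, x⁆ x w)),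
   (6, .mul x (.altVar 3 a (z * ⁅a, x⁆))), (-4, .alt a ⁅a, ⁅z, w⁆⁆ x x),
   (-4, .alt x ⁅x, ⁅z, w⁆⁆ a a), (-2, .bra z (.bra x (.bra x (.altVar 3 a a)))),
   (2, .bra z (.alt a ⁅a, w⁆ x x))]
    = true := by decide +kernel

theorem check_jprod_wronski :
    let a := var 0; let x := var 1; let b := var 2; let d := var 3
    check 4 12 (.dot (.wronski a x) (.br (.mon b) (.mon d)))
  [(32, .jordan a d ⁅a, x⁆ ⁅x, b⁆), (-4, .alt d ⁅x, b⁆ x (a * a)),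
   (52, .bra d (.mul b (.alt a x a x))), (-44, .leibniz x (a * ⁅a, x⁆) b d),
   (8, .leibniz a ⁅a, x⁆ b (x * d)), (4, .bra b (.alt a d a (x * x))),
   (-8, .alt a (x * ⁅a, b⁆) x d), (-6, .bra d (.alt x (a * a) x b)), (28, .alt x (a * x) b ⁅a, d⁆),
   (-8, .bra d (.alt a x x (a * b))), (54, .alt a d (x * b) ⁅a, x⁆),
   (16, .leibniz a (d * ⁅a, x⁆) x b), (12, .bra d (.alt a x a (x * b))),
   (-16, .mul x (.leibniz a x d ⁅a, b⁆)), (-14, .alt a d x (b * ⁅a, x⁆)),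
   (4, .alt b (a * ⁅a, x⁆) x d), (12, .bra b (.leibniz x d x (a * a))),
   (8, .mul a (.bra d (.alt x b a x))), (8, .leibniz a x b (a * ⁅x, d⁆)),
   (-10, .alt x ⁅b, d⁆ x (a * a)), (-16, .mul b (.alt a d x ⁅a, x⁆)),
   (12, .leibniz x d b (a * ⁅a, x⁆)), (-16, .mul b (.alt a x x ⁅a, d⁆)),
   (20, .mul x (.alt a x a ⁅b, d⁆)), (-48, .jordan a b ⁅a, x⁆ ⁅x, d⁆),
   (8, .mul a (.alt x ⁅x, d⁆ a b)), (-16, .leibniz a d x (b * ⁅a, x⁆)),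
   (-8, .leibniz a x d (x * ⁅a, b⁆)), (-8, .mul a (.alt x b x ⁅a, d⁆)),
   (16, .mul a (.bra x (.leibniz a d x b))), (-8, .jordan x x d ⁅a, ⁅a, b⁆⁆),
   (5, .leibniz x x ⁅b, d⁆ (a * a)), (42, .alt a x (b * d) ⁅a, x⁆),
   (24, .mul a (.leibniz x ⁅a, x⁆ b d)), (-24, .mul ⁅a, d⁆ (.alt a x x b)),
   (-32, .leibniz x d (a * b) ⁅a, x⁆), (8, .alt d ⁅a, x⁆ x (a * b)),
   (-42, .alt a x d (b * ⁅a, x⁆)), (-56, .mul b (.bra d (.alt a x a x))),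
   (20, .mul a (.leibniz x b d ⁅a, x⁆)), (-10, .mul ⁅b, d⁆ (.leibniz a x a x)),
   (-24, .mul x (.leibniz a d x ⁅a, b⁆)), (-8, .mul x (.alt b ⁅a, d⁆ a x)),
   (4, .leibniz x ⁅x, d⁆ b (a * a)), (8, .mul a (.leibniz a x x ⁅b, d⁆)),
   (-14, .alt a d b (x * ⁅a, x⁆)), (-12, .mul x (.alt a x b ⁅a, d⁆)),
   (-8, .mul x (.alt a ⁅a, b⁆ x d)), (24, .jordan x ⁅a, b⁆ ⁅a, x⁆ d),
   (24, .mul x (.bra d (.leibniz a b a x))), (8, .mul x (.alt a d a ⁅x, b⁆)),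
   (20, .alt b (d * ⁅a, x⁆) a x), (20, .alt x (a * ⁅b, d⁆) a x),
   (16, .bra x (.mul a (.alt x b a d))), (-16, .mul a (.bra x (.alt x b a d))),
   (4, .jordan a a ⁅x, b⁆ ⁅x, d⁆), (-20, .jordan a a ⁅x, ⁅b, d⁆⁆ x),
   (-4, .mul a (.alt b ⁅a, x⁆ x d)), (-24, .alt a x x (b * ⁅a, d⁆)),
   (-8, .jordan x d ⁅a, x⁆ ⁅a, b⁆), (-16, .jordan x ⁅b, d⁆ ⁅a, x⁆ a),
   (-8, .alt d (x * ⁅a, x⁆) a b), (12, .alt d ⁅a, x⁆ a (x * b)), (8, .alt x (a * ⁅x, d⁆) a b),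
   (-16, .leibniz a x x (d * ⁅a, b⁆)), (-24, .bra x (.mul a (.leibniz a d x b))),
   (12, .mul a (.alt a x d ⁅x, b⁆)), (-4, .bra d (.mul a (.alt a x x b))),
   (24, .mul b (.leibniz a ⁅a, x⁆ x d)), (-24, .alt x b d (a * ⁅a, x⁆)),
   (36, .leibniz a x x (a * ⁅b, d⁆)), (4, .alt b ⁅a, d⁆ a (x * x)),
   (-4, .bra d (.alt x b x (a * a))), (-24, .mul a (.leibniz x d x ⁅a, b⁆)),
   (42, .jordan b d ⁅a, x⁆ ⁅a, x⁆), (-20, .alt (b * d) ⁅a, x⁆ a x), (-8, .alt d (a * ⁅a, x⁆) x b),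
   (-8, .mul b (.bra d (.leibniz a x a x))), (-32, .jordan a ⁅x, b⁆ ⁅a, x⁆ d),
   (-88, .jordan a ⁅b, d⁆ ⁅a, x⁆ x), (20, .alt x (a * x) a ⁅b, d⁆),
   (-8, .jordan a b ⁅x, d⁆ ⁅a, x⁆), (16, .jordan x x ⁅a, ⁅a, b⁆⁆ d),
   (8, .jordan x x ⁅a, b⁆ ⁅a, d⁆), (-68, .alt a x x (a * ⁅b, d⁆)),
   (24, .mul a (.alt b d x ⁅a, x⁆)), (-40, .alt a (x * d) b ⁅a, x⁆),
   (-16, .leibniz x (a * b) d ⁅a, x⁆), (-16, .jordan a a ⁅x, ⁅x, d⁆⁆ b),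
   (-16, .bra x (.leibniz a d x (a * b))), (-4, .mul x (.alt d ⁅a, x⁆ a b)),
   (40, .alt a x (x * b) ⁅a, d⁆), (16, .leibniz a x x (b * ⁅a, d⁆)),
   (8, .mul a (.alt d ⁅x, b⁆ a x)), (-4, .jordan x x ⁅a, d⁆ ⁅a, b⁆),
   (68, .mul a (.alt a x x ⁅b, d⁆)), (8, .alt a ⁅a, b⁆ d (x * x)), (-8, .alt a d a (x * ⁅x, b⁆)),
   (8, .jordan a x b ⁅d, ⁅a, x⁆⁆), (-12, .bra d (.leibniz a b a (x * x))),
   (24, .jordan a ⁅x, d⁆ ⁅a, x⁆ b), (-12, .bra x (.mul a (.alt a x b d))),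
   (8, .alt x b x (a * ⁅a, d⁆)), (-8, .mul x (.leibniz a ⁅a, x⁆ b d)),
   (32, .jordan a b ⁅d, ⁅a, x⁆⁆ x), (24, .alt d (a * b) x ⁅a, x⁆),
   (104, .jordan a x ⁅b, d⁆ ⁅a, x⁆), (16, .mul ⁅a, x⁆ (.leibniz a b x d)),
   (16, .jordan x ⁅a, d⁆ ⁅a, x⁆ b), (16, .alt a x d (a * ⁅x, b⁆)), (50, .jordan x b ⁅a, x⁆ ⁅a, d⁆),
   (-8, .mul x (.bra b (.alt a d a x))), (-12, .leibniz a ⁅a, b⁆ d (x * x)),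
   (24, .mul a (.alt x b d ⁅a, x⁆)), (-6, .bra x (.alt x (a * a) b d)),
   (-2, .alt a x b (d * ⁅a, x⁆)), (-8, .leibniz x b ⁅x, d⁆ (a * a)),
   (-24, .leibniz a ⁅a, x⁆ x (b * d)), (-8, .alt x ⁅x, d⁆ b (a * a)),
   (16, .mul d (.leibniz a x x ⁅a, b⁆)), (12, .bra d (.alt x (a * x) a b)),
   (16, .jordan a a b ⁅x, ⁅x, d⁆⁆), (14, .alt x (a * a) d ⁅x, b⁆)]
    = true := by decide +kernel

end Mon

/-! ### The certified identities in an algebra -/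

section Wronskian

variable {A : Type*} [NonUnitalNonAssocRing A]

/-- The value of `Mon.Form.wronski` at two elements. -/
def wronskian (a x : A) : A :=
  jcomm (jcomm (jcomm a x) a) x - jcomm (jcomm (jcomm a x) x) a

theorem Mon.Form.eval_wronski (v : ℕ → A) (a x : Mon) :
    (Mon.Form.wronski a x).eval v = wronskian (a.eval v) (x.eval v) := by
  simp only [Mon.Form.wronski, Mon.Form.eval, wronskian, neg_one_zsmul, ← sub_eq_add_neg]

/-- The values of the variables used in the certificates. -/
def assignment (a x b d : A) : ℕ → A
  | 0 => a
  | 1 => x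
  | 2 => b
  | 3 => d
  | _ => 0

theorem rightAlternates_zero : RightAlternates (0 : A) := fun z t => by simp

theorem IsNCJordanComm.jcomm_wronskian [IsAddTorsionFree A] (hA : IsNCJordanComm A) (a x : A)
    {w : A} (hw : RightAlternates w) : jcomm (wronskian a x) w = 0 := by
  have h := Mon.eval_eq_zero_of_check (assignment a x w 0) hA 2 hw _ _ _
    Mon.check_jcomm_wronski
  rw [Mon.Form.eval, Mon.Form.eval_wronski] at h
  exact (IsAddTorsionFree.zsmul_eq_zero_iff_right (by norm_num)).1 h

theorem IsNCJordanComm.jcomm_jcomm_wronskian [IsAddTorsionFree A] (hA : IsNCJordanComm A)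
    (a x z : A) {w : A} (hw : RightAlternates w) : jcomm (jcomm (wronskian a x) z) w = 0 := by
  have h := Mon.eval_eq_zero_of_check (assignment a x z w) hA 3 hw _ _ _
    Mon.check_jcomm_jcomm_wronski
  simp only [Mon.Form.eval, Mon.Form.eval_wronski] at h
  exact (IsAddTorsionFree.zsmul_eq_zero_iff_right (by norm_num)).1 h

theorem IsNCJordanComm.jprod_wronskian [IsAddTorsionFree A] (hA : IsNCJordanComm A)
    (a x b d : A) : jprod (wronskian a x) (jcomm b d) = 0 := by
  -- This certificate contains no `altVar`; index 4 is a dummy at which the assignment has value 0.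
  have h := Mon.eval_eq_zero_of_check (assignment a x b d) hA 4 rightAlternates_zero _ _ _
    Mon.check_jprod_wronski
  rw [Mon.Form.eval, Mon.Form.eval_wronski] at h
  exact (IsAddTorsionFree.zsmul_eq_zero_iff_right (by norm_num)).1 h

end Wronskian

/-! ### Elements annihilated by all commutators -/

section Annihilators

variable {A : Type*} [NonUnitalNonAssocRing A]

theorem jprod_sub (x y z : A) : jprod x (y - z) = jprod x y - jprod x z :=
  map_sub (jprodHom x) y z

theorem sub_jprod (x y z : A) : jprod (x - y) z = jprod x z - jprod y z := by
  rw [jprod_comm, jprod_sub, jprod_comm z, jprod_comm z]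

theorem jcomm_sub (x y z : A) : jcomm x (y - z) = jcomm x y - jcomm x z :=
  map_sub (jcommHom x) y z

theorem sub_jcomm (x y z : A) : jcomm (x - y) z = jcomm x z - jcomm y z := by
  rw [jcomm_skew, jcomm_sub, jcomm_skew z x, jcomm_skew z y]
  abel

theorem jprod_neg (x y : A) : jprod x (-y) = -jprod x y := map_neg (jprodHom x) y

theorem RightAlternates.sub {v w : A} (hv : RightAlternates v) (hw : RightAlternates w) :
    RightAlternates (v - w) := by
  intro z t
  rw [← sub_zero (0 : A)]
  nth_rw 1 [← hv z t]
  rw [← hw z t]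
  simp only [sub_jcomm, sub_jprod, smul_sub]
  abel

/-- Elements behaving like commutators and annihilated by all commutators. -/
structure AnnihilatesComm (v : A) : Prop where
  rightAlternates : RightAlternates v
  jprod_jcomm : ∀ p q : A, jprod v (jcomm p q) = 0
  jcomm_jcomm : ∀ p q : A, jcomm v (jcomm p q) = 0
  jprod_jprod_jcomm : ∀ p q y : A, jprod v (jprod (jcomm p q) y) = 0
  jprod_jprod_jcomm' : ∀ p q y : A, jprod (jprod v y) (jcomm p q) = 0

/-- The derivation {·, z} applied to v·w = 0 gives {v,z}·w = 0 as soon as v·{w,z} = 0, and the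
elements c and c·y with c a commutator span a space stable under {·, z}. The vanishing of {{v,z}, c}
is what remains of `RightAlternates v` at z, c. -/
theorem AnnihilatesComm.jcomm (hA : IsNCJordanComm A) {v : A} (hv : AnnihilatesComm v) (z : A) :
    AnnihilatesComm (jcomm v z) := by
  have e1 : ∀ w : A, jprod v w = 0 → jprod v (_root_.jcomm w z) = 0 →
      jprod (_root_.jcomm v z) w = 0 := by
    intro w h1 h2
    have h := hA.jprod_jcomm v w z
    rw [h1, h2, zero_jcomm, zero_add, jprod_comm] at h
    exact h.symm
  have h1 : ∀ p q : A, jprod (_root_.jcomm v z) (_root_.jcomm p q) = 0 := fun p q =>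
    e1 _ (hv.jprod_jcomm _ _) (hv.jprod_jcomm _ _)
  refine ⟨hA.rightAlternates _ _, h1, ?_, ?_, ?_⟩
  · intro p q
    have h := hv.rightAlternates z (_root_.jcomm p q)
    rw [hv.jcomm_jcomm, zero_jcomm, add_zero, jprod_comm z, hv.jprod_jprod_jcomm, smul_zero,
      sub_zero, hv.jprod_jprod_jcomm', add_zero, hv.jprod_jcomm, zero_jprod, add_zero] at h
    exact h
  · intro p q y
    refine e1 _ (hv.jprod_jprod_jcomm _ _ _) ?_
    rw [hA.jprod_jcomm, jprod_add, hv.jprod_jprod_jcomm, zero_add, jprod_comm y,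
      hv.jprod_jprod_jcomm]
  · intro p q y
    have h := hA.jprod_jcomm v y z
    rw [hv.jprod_jcomm, zero_add, jprod_comm y] at h
    rw [← h]
    have h' := hA.jprod_jcomm (jprod v y) (_root_.jcomm p q) z
    rw [hv.jprod_jprod_jcomm', zero_jcomm, hv.jprod_jprod_jcomm', zero_add, jprod_comm] at h'
    exact h'.symm

theorem IsNCJordanComm.annihilatesComm_wronskian [IsAddTorsionFree A] (hA : IsNCJordanComm A)
    (a x : A) : AnnihilatesComm (wronskian a x) := by
  have hu : RightAlternates (wronskian a x) :=
    (hA.rightAlternates _ _).sub (hA.rightAlternates _ _)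
  have hb : ∀ p q, _root_.jcomm (wronskian a x) (_root_.jcomm p q) = 0 := fun p q =>
    hA.jcomm_wronskian a x (hA.rightAlternates p q)
  have key : ∀ p q y, jprod (wronskian a x) (jprod (_root_.jcomm p q) y) = 0 ∧
      jprod (jprod (wronskian a x) y) (_root_.jcomm p q) = 0 := by
    intro p q y
    have h1 := hu y (_root_.jcomm p q)
    rw [hA.jcomm_jcomm_wronskian a x y (hA.rightAlternates p q), hb, zero_jcomm, zero_add,
      hA.jprod_wronskian, zero_jprod, add_zero, jprod_comm y, zero_sub] at h1
    have h2 := hA.rightAlternates p q y (wronskian a x)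
    rw [jcomm_skew (_root_.jcomm p q) (wronskian a x), hb, neg_zero, zero_jcomm,
      jcomm_skew _ (wronskian a x), hb, neg_zero, zero_add, jprod_comm _ (wronskian a x),
      jprod_comm _ (wronskian a x), jprod_comm (_root_.jcomm p q) (wronskian a x),
      hA.jprod_wronskian, zero_jprod, add_zero, zero_sub,
      jprod_comm (_root_.jcomm p q) (jprod _ _)] at h2
    generalize jprod (wronskian a x) (jprod (_root_.jcomm p q) y) = α at h1 h2 ⊢
    generalize jprod (jprod (wronskian a x) y) (_root_.jcomm p q) = β at h1 h2 ⊢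
    -- `RightAlternates` for the Wronskian gives β = 2α, and for the commutator gives α = 2β.
    have h3 : (3 : ℕ) • α = 0 := by
      have : (3 : ℕ) • α = -((2 : ℤ) • (-((2 : ℤ) • α) + β) + (-((2 : ℤ) • β) + α)) := by
        simp only [smul_add, smul_neg]
        module
      rw [this, h1, h2]
      simp
    have hα : α = 0 := (nsmul_eq_zero_iff_right (by norm_num)).1 h3
    subst hα
    simpa using h1
  exact ⟨hu, hA.jprod_wronskian a x, hb, fun p q y => (key p q y).1, fun p q y => (key p q y).2⟩

end Annihilators

/-! ### Alternating sums of iterated commutators -/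

section Alternation

variable {A : Type*} [NonUnitalNonAssocRing A]

/-- The iterated commutator `{…{{v, y₀}, y₁}, …, yₘ₋₁}`. -/
def iterComm : (m : ℕ) → A → (Fin m → A) → A
  | 0, v, _ => v
  | m + 1, v, y => iterComm m (jcomm v (y 0)) (Fin.tail y)

/-- The alternating sum of iterated commutators. -/
def altIterComm (m : ℕ) (v : A) (y : Fin m → A) : A :=
  ∑ σ : Equiv.Perm (Fin m), Equiv.Perm.sign σ • iterComm m v fun i => y (σ i)

theorem iterComm_add (m : ℕ) (v w : A) (y : Fin m → A) :
    iterComm m (v + w) y = iterComm m v y + iterComm m w y := by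
  induction m generalizing v w with
  | zero => rfl
  | succ m ih => rw [iterComm, add_jcomm, ih]; rfl

theorem iterComm_zero (m : ℕ) (y : Fin m → A) : iterComm m (0 : A) y = 0 := by
  induction m with
  | zero => rfl
  | succ m ih => rw [iterComm, zero_jcomm, ih]

theorem map_jcomm {B φ : Type*} [NonUnitalNonAssocRing B] [FunLike φ A B]
    [NonUnitalRingHomClass φ A B] (f : φ) (x y : A) : f (jcomm x y) = jcomm (f x) (f y) := by
  simp [jcomm]

theorem map_wronskian {B φ : Type*} [NonUnitalNonAssocRing B] [FunLike φ A B]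
    [NonUnitalRingHomClass φ A B] (f : φ) (a x : A) :
    f (wronskian a x) = wronskian (f a) (f x) := by
  simp [wronskian, map_jcomm]

theorem map_iterComm {B φ : Type*} [NonUnitalNonAssocRing B] [FunLike φ A B]
    [NonUnitalRingHomClass φ A B] (f : φ) (m : ℕ) (v : A) (y : Fin m → A) :
    f (iterComm m v y) = iterComm m (f v) fun i => f (y i) := by
  induction m generalizing v with
  | zero => rfl
  | succ m ih => rw [iterComm, ih, map_jcomm]; rfl

theorem map_altIterComm {B φ : Type*} [NonUnitalNonAssocRing B] [FunLike φ A B]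
    [NonUnitalRingHomClass φ A B] (f : φ) (m : ℕ) (v : A) (y : Fin m → A) :
    f (altIterComm m v y) = altIterComm m (f v) fun i => f (y i) := by
  simp only [altIterComm, map_sum, Units.smul_def, map_zsmul, map_iterComm]

variable {F : Type*} [Field F] [Module F A] [IsScalarTower F A A] [SMulCommClass F A A]

theorem smul_jcomm (c : F) (x y : A) : jcomm (c • x) y = c • jcomm x y := by
  simp only [jcomm, smul_mul_assoc, mul_smul_comm, smul_sub]

theorem jcomm_smul (c : F) (x y : A) : jcomm x (c • y) = c • jcomm x y := by
  simp only [jcomm, smul_mul_assoc, mul_smul_comm, smul_sub]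

theorem iterComm_smul (m : ℕ) (c : F) (v : A) (y : Fin m → A) :
    iterComm m (c • v) y = c • iterComm m v y := by
  induction m generalizing v with
  | zero => rfl
  | succ m ih => rw [iterComm, smul_jcomm, ih]; rfl

variable (F) in
/-- `iterComm` as a multilinear map. -/
def iterCommMultilinear (m : ℕ) (v : A) : MultilinearMap F (fun _ : Fin m => A) A where
  toFun := iterComm m v
  map_update_add' := by
    intro inst y i a b
    obtain rfl : inst = instDecidableEqFin m := Subsingleton.elim _ _
    induction m generalizing v with
    | zero => exact i.elim0
    | succ m ih =>
      refine Fin.cases ?_ (fun i => ?_) i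
      · simp only [iterComm, Function.update_self, Fin.tail_update_zero, jcomm_add, iterComm_add]
      · simp only [iterComm, Fin.tail_update_succ, ih,
          Function.update_of_ne (Fin.succ_ne_zero i).symm]
  map_update_smul' := by
    intro inst y i c b
    obtain rfl : inst = instDecidableEqFin m := Subsingleton.elim _ _
    induction m generalizing v with
    | zero => exact i.elim0
    | succ m ih =>
      refine Fin.cases ?_ (fun i => ?_) i
      · simp only [iterComm, Function.update_self, Fin.tail_update_zero, jcomm_smul,
          iterComm_smul]
      · simp only [iterComm, Fin.tail_update_succ, ih,
          Function.update_of_ne (Fin.succ_ne_zero i).symm]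

theorem alternatization_iterComm (m : ℕ) (v : A) (y : Fin m → A) :
    MultilinearMap.alternatization (iterCommMultilinear F m v) y = altIterComm m v y := by
  rw [MultilinearMap.alternatization_apply]
  rfl

/-- The partial bracket reached just before slot i still annihilates commutators. -/
theorem iterComm_update_jcomm (hA : IsNCJordanComm A) {m : ℕ} {v : A} (hv : AnnihilatesComm v)
    (y : Fin m → A) (i : Fin m) (p q : A) :
    iterComm m v (Function.update y i (jcomm p q)) = 0 := by
  induction m generalizing v with
  | zero => exact i.elim0
  | succ m ih =>
    refine Fin.cases ?_ (fun i => ?_) i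
    · rw [iterComm, Function.update_self, hv.jcomm_jcomm, iterComm_zero]
    · rw [iterComm, Fin.tail_update_succ, Function.update_of_ne (Fin.succ_ne_zero i).symm,
        ih (hv.jcomm hA _)]

/-- In {a·v, y} = a·{v,y} + v·{a,y} the last term vanishes, so the factor a moves outside all later
brackets. This makes each slot a derivation in the next lemma. -/
theorem iterComm_jprod (hA : IsNCJordanComm A) {m : ℕ} {v : A} (hv : AnnihilatesComm v)
    (y : Fin m → A) (a : A) : iterComm m (jprod a v) y = jprod a (iterComm m v y) := by
  induction m generalizing v with
  | zero => rfl
  | succ m ih =>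
    rw [iterComm, hA.jprod_jcomm, hv.jprod_jcomm, add_zero, ih (hv.jcomm hA _)]
    rfl

theorem iterComm_update_jprod (hA : IsNCJordanComm A) {m : ℕ} {v : A} (hv : AnnihilatesComm v)
    (y : Fin m → A) (i : Fin m) (a b : A) :
    iterComm m v (Function.update y i (jprod a b)) =
      jprod a (iterComm m v (Function.update y i b)) +
        jprod b (iterComm m v (Function.update y i a)) := by
  induction m generalizing v with
  | zero => exact i.elim0
  | succ m ih =>
    refine Fin.cases ?_ (fun i => ?_) i
    · simp only [iterComm, Function.update_self, Fin.tail_update_zero, hA.jcomm_jprod,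
        iterComm_add, iterComm_jprod hA (hv.jcomm hA _)]
    · simp only [iterComm, Fin.tail_update_succ,
        Function.update_of_ne (Fin.succ_ne_zero i).symm, ih (hv.jcomm hA _)]

theorem update_comp_perm {X : Type*} {m : ℕ} (y : Fin m → X) (i : Fin m) (z : X)
    (σ : Equiv.Perm (Fin m)) :
    (fun j => Function.update y i z (σ j)) =
      Function.update (fun j => y (σ j)) (σ.symm i) z := by
  simpa [Function.comp_def] using Function.update_comp_equiv y σ i z

theorem altIterComm_update_jcomm (hA : IsNCJordanComm A) {m : ℕ} {v : A}
    (hv : AnnihilatesComm v) (y : Fin m → A) (i : Fin m) (p q : A) :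
    altIterComm m v (Function.update y i (jcomm p q)) = 0 := by
  simp only [altIterComm, update_comp_perm, iterComm_update_jcomm hA hv, smul_zero,
    Finset.sum_const_zero]

theorem altIterComm_update_jprod (hA : IsNCJordanComm A) {m : ℕ} {v : A}
    (hv : AnnihilatesComm v) (y : Fin m → A) (i : Fin m) (a b : A) :
    altIterComm m v (Function.update y i (jprod a b)) =
      jprod a (altIterComm m v (Function.update y i b)) +
        jprod b (altIterComm m v (Function.update y i a)) := by
  simp only [altIterComm, update_comp_perm, iterComm_update_jprod hA hv, smul_add,
    Finset.sum_add_distrib]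
  simp only [← jprodHom_apply, map_sum, Units.smul_def, map_zsmul]

/-- An alternating sum of iterated commutators of length greater than the number of generators
vanishes. -/
theorem altIterComm_eq_zero [IsAddTorsionFree A] (hA : IsNCJordanComm A) {n m : ℕ} (hnm : n < m)
    (g : Fin n → A) (hg : ∀ S : Submodule F A, (∀ i, g i ∈ S) →
      (∀ x ∈ S, ∀ y ∈ S, x * y ∈ S) → S = ⊤)
    {v : A} (hv : AnnihilatesComm v) (y : Fin m → A) : altIterComm m v y = 0 := by
  -- Slots from k on hold generators, and slots before k are arbitrary. For k = 0 the pigeonhole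
  -- principle gives a repeated entry; passing to k + 1 frees slot k, because the elements z that
  -- give 0 there form a subalgebra containing the generators.
  have key : ∀ k : ℕ, ∀ y : Fin m → A, (∀ i : Fin m, k ≤ i → y i ∈ Set.range g) →
      altIterComm m v y = 0 := by
    intro k
    induction k with
    | zero =>
      intro y hy
      choose j hj using fun i => hy i (Nat.zero_le _)
      obtain ⟨a, b, hab, h⟩ := Fintype.exists_ne_map_eq_of_card_lt j (by simpa using hnm)
      rw [← alternatization_iterComm (F := F)]
      exact AlternatingMap.map_eq_zero_of_eq _ y (by rw [← hj a, ← hj b, h]) hab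
    | succ k ih =>
      intro y hy
      by_cases hk : k < m
      swap
      · exact ih y fun i hi => absurd i.isLt (by omega)
      let i : Fin m := ⟨k, hk⟩
      let S : Submodule F A := LinearMap.ker
        ((MultilinearMap.alternatization (iterCommMultilinear F m v)).toLinearMap y i)
      have hS : ∀ z, z ∈ S ↔ altIterComm m v (Function.update y i z) = 0 := by
        intro z
        rw [← alternatization_iterComm (F := F)]
        rfl
      have hT : S = ⊤ := by
        refine hg S (fun j => (hS _).2 (ih _ fun l hl => ?_)) fun a ha b hb => ?_
        · rcases eq_or_ne l i with rfl | hl'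
          · rw [Function.update_self]
            exact ⟨j, rfl⟩
          · rw [Function.update_of_ne hl']
            refine hy l ?_
            have : (l : ℕ) ≠ k := fun h => hl' (Fin.ext h)
            omega
        · have h1 : jprod a b ∈ S := by
            rw [hS] at ha hb ⊢
            rw [altIterComm_update_jprod hA hv, ha, hb, jprod_zero, jprod_zero, add_zero]
          have h2 : jcomm a b ∈ S := (hS _).2 (altIterComm_update_jcomm hA hv y i a b)
          have h3 : (2 : ℕ) • (a * b) ∈ S := by
            have : (2 : ℕ) • (a * b) = jprod a b + jcomm a b := by
              simp only [jprod, jcomm]; abel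
            rw [this]
            exact S.add_mem h1 h2
          rw [hS, ← alternatization_iterComm (F := F)] at h3 ⊢
          rw [two_nsmul, AlternatingMap.map_update_add, ← two_nsmul] at h3
          exact (nsmul_eq_zero_iff_right (by norm_num)).1 h3
      have hy' : y i ∈ S := hT ▸ Submodule.mem_top
      rwa [hS, Function.update_eq_self] at hy'
  exact key m y fun i hi => absurd i.isLt (by omega)

end Alternation

/-! ### From the defining identities to their polarized forms -/

section Linearization

theorem isAddTorsionFree_of_module (F : Type*) [Field F] [CharZero F] (A : Type*)
    [AddCommGroup A] [Module F A] : IsAddTorsionFree A where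
  nsmul_right_injective n hn := fun x y h => by
    have h' : (n : F) • x = (n : F) • y := by
      simpa only [Nat.cast_smul_eq_nsmul] using h
    exact smul_right_injective A (Nat.cast_ne_zero.2 hn) h'

variable {F : Type*} [Field F] {A : Type*} [NonUnitalNonAssocRing A] [Module F A]
  [IsScalarTower F A A] [SMulCommClass F A A]

theorem satisfiesIdentities_ncJordanComm_iff :
    SatisfiesIdentities (ncJordanCommIdentities F) A ↔
      (∀ x y : A, x * y * x = x * (y * x)) ∧ (∀ x y : A, x * x * y * x = x * x * (y * x)) ∧
        ∀ x y z : A, (x * y - y * x) * z * z = (x * y - y * x) * (z * z) := by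
  simp only [SatisfiesIdentities, ncJordanCommIdentities, ncJordanIdentities, NAPoly.var,
    Set.mem_union, Set.mem_insert_iff, Set.mem_singleton_iff, associator]
  constructor
  · intro h
    refine ⟨fun x y => ?_, fun x y => ?_, fun x y z => ?_⟩
    · simpa [sub_eq_zero] using h _ (.inl (.inl rfl)) (fun i => if i = 0 then x else y)
    · simpa [sub_eq_zero] using h _ (.inl (.inr rfl)) (fun i => if i = 0 then x else y)
    · simpa [sub_eq_zero] using
        h _ (.inr rfl) (fun i => if i = 0 then x else if i = 1 then y else z)
  · rintro ⟨h1, h2, h3⟩ f ((rfl | rfl) | rfl) a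
    · simpa [sub_eq_zero] using h1 (a 0) (a 1)
    · simpa [sub_eq_zero] using h2 (a 0) (a 1)
    · simpa [sub_eq_zero] using h3 (a 0) (a 1) (a 2)

end Linearization

section Polarization

variable {A : Type*} [NonUnitalNonAssocRing A]

theorem jprod_jcomm_of_flexible (h : ∀ x y : A, x * y * x = x * (y * x)) (x y z : A) :
    jcomm (jprod x y) z = jprod x (jcomm y z) + jprod y (jcomm x z) := by
  have lin : ∀ x y z : A, x * y * z + z * y * x = x * (y * z) + z * (y * x) := by
    intro x y z
    have h1 := h (x + z) y
    simp only [add_mul, mul_add, h x y, h z y] at h1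
    linear_combination (norm := abel) h1
  simp only [jcomm, jprod, mul_sub, sub_mul, mul_add, add_mul]
  linear_combination (norm := abel) lin x y z + lin y x z - lin y z x

/-- Expansion of both products in each term by 2ab = a·b + {a,b}. With s = x² the three groups
involving commutators vanish in a flexible algebra, leaving the Jordan identity. -/
theorem jprod_associator_add (s y x : A) :
    jprod (jprod s y) x - jprod s (jprod y x) + (jcomm (jprod s y) x - jprod s (jcomm y x)) +
      (jprod x (jcomm s y) - jcomm s (jprod y x)) +
      (jcomm (jcomm s y) x - jcomm s (jcomm y x)) = (4 : ℕ) • (s * y * x - s * (y * x)) := by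
  simp only [jcomm, jprod, mul_sub, sub_mul, mul_add, add_mul]
  abel

theorem jordan_of_flexible [IsAddTorsionFree A] (h : ∀ x y : A, x * y * x = x * (y * x))
    (h2 : ∀ x y : A, x * x * y * x = x * x * (y * x)) (x y : A) :
    jprod (jprod (jprod x x) y) x = jprod (jprod x x) (jprod y x) := by
  have leib := jprod_jcomm_of_flexible h
  have e1 : jcomm (x * x) x = 0 := by rw [jcomm, h x x, sub_self]
  have e2 : ∀ t, jcomm (x * x) t = jprod x (jcomm x t) := by
    intro t
    have h3 := leib x x t
    have h4 : jprod x x = x * x + x * x := rfl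
    rw [h4, add_jcomm, ← two_nsmul, ← two_nsmul] at h3
    exact nsmul_right_injective (two_ne_zero) h3
  have e3 : jcomm (jprod (x * x) y) x = jprod (x * x) (jcomm y x) := by
    rw [leib, e1, jprod_zero, add_zero]
  have e4 : jcomm (x * x) (jprod y x) = jprod x (jcomm (x * x) y) := by
    rw [jcomm_skew, leib, jcomm_skew x, e1, neg_zero, jprod_zero, zero_add, ← jprod_neg,
      ← jcomm_skew]
  have e5 : jcomm (jcomm (x * x) y) x = jcomm (x * x) (jcomm y x) := by
    rw [e2, e2, leib, jcomm_self, jprod_zero, add_zero, jcomm_skew x y, jcomm_skew x (jcomm y x)]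
    rw [← zero_sub (jcomm y x), sub_jcomm, zero_jcomm, zero_sub]
  have h5 := jprod_associator_add (x * x) y x
  rw [h2, sub_self, smul_zero, e3, e4, e5, sub_self, sub_self, sub_self, add_zero, add_zero,
    add_zero, sub_eq_zero] at h5
  have h4 : jprod x x = x * x + x * x := rfl
  rw [h4, add_jprod, add_jprod, add_jprod, h5]

/-- Inclusion-exclusion on x + y + z gives all six permutations, which by symmetry in the first two
arguments is twice the cyclic sum. -/
theorem polarize_of_symm {B C : Type*} [AddCommGroup B] [AddCommGroup C] [IsAddTorsionFree C]
    (c : B →+ B →+ B →+ C) (hc : ∀ x y z, c x y z = c y x z) (h : ∀ x, c x x x = 0)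
    (x y z : B) : c x y z + c y z x + c z x y = 0 := by
  have h1 := h (x + y + z)
  have h2 := h (x + y)
  have h3 := h (y + z)
  have h4 := h (x + z)
  simp only [map_add, AddMonoidHom.add_apply, h, hc y x, hc z x, hc z y] at h1 h2 h3 h4
  refine (nsmul_eq_zero_iff_right (n := 2) (by norm_num)).1 ?_
  rw [hc z x]
  linear_combination (norm := abel) h1 - h2 - h3 - h4

theorem jordanDefect_eq_zero [IsAddTorsionFree A]
    (h : ∀ x y : A, jprod (jprod (jprod x x) y) x = jprod (jprod x x) (jprod y x))
    (x z t y : A) : jordanDefect x z t y = 0 := by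
  let c : A →+ A →+ A →+ A := AddMonoidHom.mk' (fun x => AddMonoidHom.mk' (fun z =>
    AddMonoidHom.mk' (fun t => jprod (jprod (jprod x z) y) t - jprod (jprod x z) (jprod y t))
      (by intros; simp only [jprod_add]; abel))
      (by intros; ext; simp only [jprod_add, add_jprod, AddMonoidHom.mk'_apply,
        AddMonoidHom.add_apply]; abel))
    (by intros; ext; simp only [add_jprod, AddMonoidHom.mk'_apply, AddMonoidHom.add_apply]; abel)
  refine polarize_of_symm c (fun x z t => ?_) (fun x => sub_eq_zero.2 (h x y)) x z t
  change jprod (jprod (jprod x z) y) t - jprod (jprod x z) (jprod y t) =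
    jprod (jprod (jprod z x) y) t - jprod (jprod z x) (jprod y t)
  rw [jprod_comm x z]

theorem rightAlternates_of_flexible (h : ∀ x y : A, x * y * x = x * (y * x)) {w : A}
    (hw : ∀ z, w * z * z = w * (z * z)) : RightAlternates w := by
  intro z t
  have lin : w * z * t + w * t * z = w * (z * t) + w * (t * z) := by
    have h1 := hw (z + t)
    simp only [add_mul, mul_add, hw] at h1
    linear_combination (norm := abel) h1
  have h1 := jprod_jcomm_of_flexible h w z t
  have h2 := jprod_jcomm_of_flexible h w t z
  have h3 := jprod_jcomm_of_flexible h z t w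
  simp only [jcomm, jprod, mul_sub, sub_mul, mul_add, add_mul] at h1 h2 h3 ⊢
  linear_combination (norm := abel) lin + lin + lin + lin - h1 - h2 - h3 - h3

theorem IsNCJordanComm.of_identities [IsAddTorsionFree A]
    (h : ∀ x y : A, x * y * x = x * (y * x))
    (h2 : ∀ x y : A, x * x * y * x = x * x * (y * x))
    (h3 : ∀ x y z : A, (x * y - y * x) * z * z = (x * y - y * x) * (z * z)) :
    IsNCJordanComm A where
  jprod_jcomm := jprod_jcomm_of_flexible h
  jordan := jordanDefect_eq_zero (jordan_of_flexible h h2)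
  rightAlternates x y := rightAlternates_of_flexible h (h3 x y)

end Polarization

/-! ### An algebra in which long alternating sums do not vanish -/

section Wedge

variable (F : Type*) [Field F] (m : ℕ)

/-- The space underlying an anticommutative algebra built on the exterior algebra of
`F ^ (m + 2)`. -/
def WedgeAlgebra : Type _ := (Fin (m + 2) → F) × ExteriorAlgebra F (Fin (m + 2) → F)

namespace WedgeAlgebra

noncomputable instance : AddCommGroup (WedgeAlgebra F m) :=
  inferInstanceAs (AddCommGroup ((Fin (m + 2) → F) × ExteriorAlgebra F (Fin (m + 2) → F)))

noncomputable instance : Module F (WedgeAlgebra F m) :=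
  inferInstanceAs (Module F ((Fin (m + 2) → F) × ExteriorAlgebra F (Fin (m + 2) → F)))

open ExteriorAlgebra in
/-- `(x, e) (y, e') = (0, x₀ y₁ - x₁ y₀ + e ∧ y - e' ∧ x)`. -/
noncomputable instance : Mul (WedgeAlgebra F m) where
  mul p q := (0, algebraMap F _ (p.1 0 * q.1 1 - p.1 1 * q.1 0) + p.2 * ι F q.1 - q.2 * ι F p.1)

variable {F m}

theorem fst_add (p q : WedgeAlgebra F m) : (p + q).1 = p.1 + q.1 := rfl

theorem snd_add (p q : WedgeAlgebra F m) : (p + q).2 = p.2 + q.2 := rfl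

theorem fst_smul (c : F) (q : WedgeAlgebra F m) : (c • q).1 = c • q.1 := rfl

theorem snd_smul (c : F) (q : WedgeAlgebra F m) : (c • q).2 = c • q.2 := rfl

open ExteriorAlgebra in
theorem snd_mul (p q : WedgeAlgebra F m) : (p * q).2 =
    algebraMap F _ (p.1 0 * q.1 1 - p.1 1 * q.1 0) + p.2 * ι F q.1 - q.2 * ι F p.1 := rfl

theorem mul_skew (p q : WedgeAlgebra F m) : p * q = -(q * p) := by
  refine Prod.ext (neg_zero).symm ?_
  change (p * q).2 = -(q * p).2
  rw [snd_mul, snd_mul, mul_comm (p.1 0), mul_comm (p.1 1), ← neg_sub (q.1 0 * p.1 1), map_neg]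
  abel

theorem mul_add' (p q r : WedgeAlgebra F m) : p * (q + r) = p * q + p * r := by
  refine Prod.ext (add_zero _).symm ?_
  change (p * (q + r)).2 = (p * q).2 + (p * r).2
  simp only [snd_mul, fst_add, snd_add, map_add, mul_add, add_mul, Pi.add_apply, map_sub]
  abel

theorem mul_smul' (c : F) (p q : WedgeAlgebra F m) : p * (c • q) = c • (p * q) := by
  refine Prod.ext (smul_zero _).symm ?_
  change (p * (c • q)).2 = c • (p * q).2
  have e : p.1 0 * (c * q.1 1) - p.1 1 * (c * q.1 0) = c * (p.1 0 * q.1 1 - p.1 1 * q.1 0) := by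
    ring
  simp only [snd_mul, fst_smul, snd_smul, map_smul, mul_smul_comm, smul_mul_assoc, Pi.smul_apply,
    smul_sub, smul_add, smul_eq_mul, e, map_mul, Algebra.smul_def c (algebraMap F _ _)]

noncomputable instance : NonUnitalNonAssocRing (WedgeAlgebra F m) where
  left_distrib := mul_add'
  right_distrib p q r := by
    rw [mul_skew, mul_add', neg_add, ← mul_skew, ← mul_skew]
  zero_mul p := by
    rw [mul_skew, ← zero_smul F (0 : WedgeAlgebra F m), mul_smul', zero_smul, neg_zero, zero_smul]
  mul_zero p := by
    rw [← zero_smul F (0 : WedgeAlgebra F m), mul_smul', zero_smul, zero_smul]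

instance : SMulCommClass F (WedgeAlgebra F m) (WedgeAlgebra F m) where
  smul_comm c p q := (mul_smul' c p q).symm

instance : IsScalarTower F (WedgeAlgebra F m) (WedgeAlgebra F m) where
  smul_assoc c p q := by
    rw [smul_eq_mul, smul_eq_mul, mul_skew, mul_smul', ← smul_neg, ← mul_skew]

theorem mul_self_eq_zero' (p : WedgeAlgebra F m) : p * p = 0 := by
  refine Prod.ext rfl ?_
  change (p * p).2 = 0
  rw [snd_mul, mul_comm (p.1 0), sub_self, map_zero, zero_add, sub_self]

variable (F m) in
/-- The inclusion of the exterior algebra. -/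
noncomputable def inr : ExteriorAlgebra F (Fin (m + 2) → F) →ₗ[F] WedgeAlgebra F m where
  toFun e := (0, e)
  map_add' _ _ := Prod.ext (add_zero _).symm rfl
  map_smul' _ _ := Prod.ext (smul_zero _).symm rfl

open ExteriorAlgebra in
theorem inr_mul (e : ExteriorAlgebra F (Fin (m + 2) → F)) (z : WedgeAlgebra F m) :
    inr F m e * z = inr F m (e * ι F z.1) := by
  refine Prod.ext rfl ?_
  change (inr F m e * z).2 = e * ι F z.1
  have h1 : (inr F m e).1 = 0 := rfl
  have h2 : (inr F m e).2 = e := rfl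
  rw [snd_mul, h1, h2]
  simp

theorem mul_eq_inr (p q : WedgeAlgebra F m) : p * q = inr F m (p * q).2 := rfl

open ExteriorAlgebra in
theorem inr_mul_mul (e : ExteriorAlgebra F (Fin (m + 2) → F)) (z : WedgeAlgebra F m) :
    inr F m e * z * z = 0 := by
  rw [inr_mul, inr_mul, mul_assoc, ι_sq_zero, mul_zero, map_zero]

/-- Anticommutativity gives the first two identities. Every product lies in the exterior part, where
right multiplication by z is wedging with a vector, which squares to zero. -/
theorem satisfiesIdentities :
    SatisfiesIdentities (ncJordanCommIdentities F) (WedgeAlgebra F m) := by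
  rw [satisfiesIdentities_ncJordanComm_iff]
  refine ⟨fun x y => ?_, fun x y => ?_, fun x y z => ?_⟩
  · rw [mul_skew (x * y) x, mul_skew x y, mul_neg, neg_neg]
  · rw [mul_self_eq_zero', zero_mul, zero_mul, zero_mul]
  · rw [mul_self_eq_zero', mul_zero, mul_skew y x, sub_neg_eq_add, mul_eq_inr x y, ← map_add,
      inr_mul_mul]

theorem jcomm_eq (p q : WedgeAlgebra F m) : jcomm p q = (2 : F) • (p * q) := by
  rw [jcomm, mul_skew q p, sub_neg_eq_add, two_smul]

open ExteriorAlgebra in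
theorem jcomm_inr (e : ExteriorAlgebra F (Fin (m + 2) → F)) (z : WedgeAlgebra F m) :
    jcomm (inr F m e) z = inr F m ((2 : F) • (e * ι F z.1)) := by
  rw [jcomm_eq, inr_mul, map_smul]

open ExteriorAlgebra in
theorem iterComm_inr (n : ℕ) (e : ExteriorAlgebra F (Fin (m + 2) → F))
    (y : Fin n → WedgeAlgebra F m) :
    iterComm n (inr F m e) y =
      inr F m ((2 : F) ^ n • (e * ιMulti F n fun i => (y i).1)) := by
  induction n generalizing e with
  | zero => simp [iterComm]
  | succ n ih =>
    rw [iterComm, jcomm_inr, ih, ιMulti_succ_apply, smul_mul_assoc, smul_smul, ← pow_succ,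
      mul_assoc]
    rfl

open ExteriorAlgebra in
-- The wedge is already alternating, so all n! signed terms are equal.
theorem altIterComm_inr (n : ℕ) (e : ExteriorAlgebra F (Fin (m + 2) → F))
    (y : Fin n → WedgeAlgebra F m) :
    altIterComm n (inr F m e) y =
      inr F m ((n.factorial * 2 ^ n : F) • (e * ιMulti F n fun i => (y i).1)) := by
  have h : ∀ σ : Equiv.Perm (Fin n), Equiv.Perm.sign σ • iterComm n (inr F m e) (fun i => y (σ i))
      = inr F m ((2 : F) ^ n • (e * ιMulti F n fun i => (y i).1)) := by
    intro σ
    have h1 : (ιMulti F n fun i => (y (σ i)).1) =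
        Equiv.Perm.sign σ • ιMulti F n fun i => (y i).1 :=
      AlternatingMap.map_perm (ιMulti F n) (fun i => (y i).1) σ
    rw [iterComm_inr, h1, Units.smul_def, Units.smul_def, mul_smul_comm, smul_comm, map_zsmul,
      smul_smul, ← Units.val_mul, Int.units_mul_self, Units.val_one, one_smul]
  rw [altIterComm, Finset.sum_congr rfl fun σ _ => h σ, Finset.sum_const, Finset.card_univ,
    Fintype.card_perm, Fintype.card_fin, ← map_nsmul, ← Nat.cast_smul_eq_nsmul F, smul_smul]

theorem ιMulti_basis_ne_zero (k : ℕ) :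
    ExteriorAlgebra.ιMulti F k (fun i : Fin k => (Pi.single i 1 : Fin k → F)) ≠ 0 := by
  intro h
  have h1 := ExteriorAlgebra.liftAlternating_apply_ιMulti
    -- The functional that is the determinant in degree k and zero in other degrees takes the value
    -- 1 on the top form.
    (Pi.single (M := fun i => (Fin k → F) [⋀^Fin i]→ₗ[F] F) k (Pi.basisFun F (Fin k)).det)
    (fun i : Fin k => (Pi.single i 1 : Fin k → F))
  rw [h, map_zero, Pi.single_eq_same] at h1
  have h2 := (Pi.basisFun F (Fin k)).det_self
  have h3 : (⇑(Pi.basisFun F (Fin k)) : Fin k → Fin k → F) = fun i => Pi.single i 1 := by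
    ext i j
    simp
  rw [h3, ← h1] at h2
  exact zero_ne_one h2

/-- The vector `x` with zero exterior part. -/
def inl (x : Fin (m + 2) → F) : WedgeAlgebra F m := (x, 0)

theorem fst_inl (x : Fin (m + 2) → F) : (inl x).1 = x := rfl

theorem snd_inl (x : Fin (m + 2) → F) : (inl x).2 = 0 := rfl

variable (F m) in
/-- The standard basis vectors, and `0` beyond the last of them. -/
noncomputable def gen (j : ℕ) : WedgeAlgebra F m :=
  if h : j < m + 2 then inl (Pi.single ⟨j, h⟩ 1) else 0

theorem fst_gen (i : Fin (m + 2)) : (gen F m i).1 = Pi.single i 1 := by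
  rw [gen, dif_pos i.isLt, fst_inl]

open ExteriorAlgebra in
-- The scalar term of the product makes {e₀, e₁} = 2 in the exterior algebra. Two further brackets
-- give 8(e₀ ∧ e₁ - e₁ ∧ e₀) = 16 e₀ ∧ e₁.
theorem wronskian_gen : wronskian (gen F m 0) (gen F m 1) =
    inr F m ((16 : F) • (ι F (gen F m 0).1 * ι F (gen F m 1).1)) := by
  have h : jcomm (gen F m 0) (gen F m 1) = inr F m ((2 : F) • 1) := by
    rw [jcomm_eq, map_smul]
    congr 1
    refine Prod.ext rfl ?_
    change (gen F m 0 * gen F m 1).2 = 1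
    have h0 : gen F m 0 = inl (Pi.single 0 1) := by simp [gen]
    have h1 : gen F m 1 = inl (Pi.single 1 1) := by simp [gen]
    rw [snd_mul, h0, h1]
    simp only [fst_inl, snd_inl]
    simp
  have hs : ι F (gen F m 1).1 * ι F (gen F m 0).1 = -(ι F (gen F m 0).1 * ι F (gen F m 1).1) :=
    eq_neg_of_add_eq_zero_left (ι_add_mul_swap _ _)
  rw [wronskian, h, jcomm_inr, jcomm_inr, jcomm_inr, jcomm_inr, ← map_sub]
  congr 1
  simp only [smul_mul_assoc, one_mul, smul_smul, hs]
  module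

theorem altIterComm_gen_ne_zero [CharZero F] :
    altIterComm m (wronskian (gen F m 0) (gen F m 1)) (fun i => gen F m (i + 2)) ≠ 0 := by
  rw [wronskian_gen, altIterComm_inr, smul_mul_assoc, smul_smul, mul_assoc]
  intro h
  have h1 := congrArg Prod.snd h
  change _ • _ = 0 at h1
  rw [smul_eq_zero] at h1
  rcases h1 with h1 | h1
  · revert h1
    have : (m.factorial : F) ≠ 0 := Nat.cast_ne_zero.2 m.factorial_ne_zero
    norm_num [this]
  · refine ιMulti_basis_ne_zero (F := F) (m + 2) ?_
    rw [ExteriorAlgebra.ιMulti_succ_apply, ExteriorAlgebra.ιMulti_succ_apply, ← h1, mul_assoc]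
    simp only [← fst_gen]
    rfl

end WedgeAlgebra

end Wedge

/-! ### Relatively free algebras and the separating identity -/

namespace VarietyFree

variable {F : Type*} [Field F] (I : Set (NAPoly F ℕ)) (X : Type*)

/-- The quotient map as a homomorphism of algebras. -/
noncomputable def mkHom : NAPoly F X →ₙₐ[F] VarietyFree I X :=
  { mk I X with
    map_zero' := map_zero (mk I X)
    map_mul' := mk_mul I X }

theorem mkHom_surjective : Function.Surjective (mkHom I X) := mk_surjective I X

theorem mkHom_eq_zero {p : NAPoly F X} (hp : p ∈ verbalIdeal I X) : mkHom I X p = 0 :=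
  (Submodule.Quotient.mk_eq_zero _).2 hp

theorem satisfiesIdentities : SatisfiesIdentities I (VarietyFree I X) := by
  intro f hf a
  choose p hp using fun i => mkHom_surjective I X (a i)
  have h : FreeNonUnitalNonAssocAlgebra.lift F a =
      (mkHom I X).comp (FreeNonUnitalNonAssocAlgebra.lift F p) := by
    refine FreeNonUnitalNonAssocAlgebra.hom_ext F fun i => ?_
    simp only [NonUnitalAlgHom.comp_apply,
      FreeNonUnitalNonAssocAlgebra.lift_of_apply, hp]
  rw [h, NonUnitalAlgHom.comp_apply]
  refine mkHom_eq_zero I X ?_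
  rw [verbalIdeal, Submodule.mem_sInf]
  exact fun J hJ => hJ.1 f hf p

/-- By freeness the quotient map factors through the subalgebra S, and it is surjective. -/
theorem eq_top_of_generators_mem (S : Submodule F (VarietyFree I X))
    (hg : ∀ i, mkHom I X (FreeNonUnitalNonAssocAlgebra.of F i) ∈ S)
    (hmul : ∀ x ∈ S, ∀ y ∈ S, x * y ∈ S) : S = ⊤ := by
  let T : NonUnitalSubalgebra F (VarietyFree I X) :=
    { S with mul_mem' := fun {a b} ha hb => hmul a ha b hb }
  have h : mkHom I X = (NonUnitalSubalgebraClass.subtype T).comp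
      (FreeNonUnitalNonAssocAlgebra.lift F fun i => (⟨_, hg i⟩ : T)) := by
    refine FreeNonUnitalNonAssocAlgebra.hom_ext F fun i => ?_
    simp only [NonUnitalAlgHom.comp_apply,
      FreeNonUnitalNonAssocAlgebra.lift_of_apply]
    rfl
  refine eq_top_iff.2 fun z _ => ?_
  obtain ⟨p, rfl⟩ := mkHom_surjective I X z
  rw [h]
  exact (FreeNonUnitalNonAssocAlgebra.lift F (fun i => (⟨_, hg i⟩ : T)) p).2

end VarietyFree

/-- An alternating sum of iterated commutators in the free algebra. -/
noncomputable def altPoly (F : Type*) [Field F] (m : ℕ) : NAPoly F ℕ :=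
  altIterComm m (wronskian (NAPoly.var F 0) (NAPoly.var F 1)) fun i => NAPoly.var F (i + 2)

theorem lift_altPoly {F : Type*} [Field F] {A : Type*} [NonUnitalNonAssocRing A] [Module F A]
    [IsScalarTower F A A] [SMulCommClass F A A] (m : ℕ) (a : ℕ → A) :
    FreeNonUnitalNonAssocAlgebra.lift F a (altPoly F m) =
      altIterComm m (wronskian (a 0) (a 1)) fun i => a (i + 2) := by
  rw [altPoly, map_altIterComm, map_wronskian]
  simp only [FreeNonUnitalNonAssocAlgebra.lift_of_apply]

theorem altPoly_mem_rankSubvariety (F : Type*) [Field F] [CharZero F] (n : ℕ) :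
    altPoly F (n + 1) ∈ rankSubvariety (ncJordanCommIdentities F) n := by
  intro a
  let A := VarietyFree (ncJordanCommIdentities F) (Fin n)
  have : IsAddTorsionFree A := isAddTorsionFree_of_module F A
  have h := satisfiesIdentities_ncJordanComm_iff.1
    (VarietyFree.satisfiesIdentities (ncJordanCommIdentities F) (Fin n))
  have hA : IsNCJordanComm A := .of_identities h.1 h.2.1 h.2.2
  rw [lift_altPoly]
  exact altIterComm_eq_zero (F := F) hA n.lt_succ_self _
    (VarietyFree.eq_top_of_generators_mem (ncJordanCommIdentities F) (Fin n))
    (hA.annihilatesComm_wronskian _ _) _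

theorem not_sameVariety_rankSubvariety (F : Type*) [Field F] [CharZero F] (n : ℕ) :
    ¬ SameVariety (rankSubvariety (ncJordanCommIdentities F) n) (ncJordanCommIdentities F) := by
  intro h
  have h1 := (h (WedgeAlgebra F (n + 1))).2 WedgeAlgebra.satisfiesIdentities _
    (altPoly_mem_rankSubvariety F n) (WedgeAlgebra.gen F (n + 1))
  rw [lift_altPoly] at h1
  exact WedgeAlgebra.altIterComm_gen_ne_zero h1

theorem mainTheorem4 (F : Type*) [Field F] [CharZero F] :
    basicRank (ncJordanCommIdentities F) = ⊤ := by
  -- The infimum is `⊤` because the set of admissible ranks is empty.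
  rw [basicRank, sInf_eq_top]
  rintro r ⟨n, -, -, h⟩
  exact absurd h (not_sameVariety_rankSubvariety F n)
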